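/- **Tree MDPs.** For an integer $H\ge 1$, $\gamma\in(0,1)$, a leaf $s^*$ and an action $a^*$, let $M_H=M_H(\gamma,s^*,a^*)$ be the following deterministic MDP with discount $\gamma$, two actions and $|\mathcal S|=2^H$ states: the $2^H-1$ nodes of the full binary tree with $H$ levels, and one absorbing terminal state. Episodes start at the root; at an inner node the first action leads to the left child and the second to the right child; at a leaf (a node of the last level) both actions lead to the terminal state. The reward is $1$ for taking $a^*$ at $s^*$ and $0$ otherwise. Let $(\mathcal B^*Q)(s,a)=r(s,a)+\gamma\,\mathbb E_{s'}[\max_{a'}Q(s',a')]$, let $Q^*$ be its fixed point, and let $d^\pi(s,a)=(1-\gamma)\sum_{t\ge0}\gamma^t\,\mathbb P^\pi(s_t=s)\,\pi(a\mid s)$. **Algorithm.** Given features $\Phi\in\mathbb R^{(\mathcal S\times\mathcal A)\times d}$ (rows $\phi(s,a)$), write $Q_w=\Phi w$. Given policies $\pi_0,\pi_1,\dots$, exact projected fitted Q-iteration produces weights $w_0,w_1,\dots$ with $w_0$ given and $$w_{k+1}\in\arg\min_{w}\ \mathbb E_{(s,a)\sim\mu_k}\big[(Q_w(s,a)-(\mathcal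 B^*Q_{w_k})(s,a))^2\big],$$ where either $\mu_k=d^{\pi_k}$ for all $k$ (on-policy) or $\mu_k=\frac1{k+1}\sum_{i=0}^k d^{\pi_i}$ for all $k$ (replay buffer). **Theorem.** There is a universal constant $C>0$ such that for all $\varepsilon,\gamma\in(0,1)$ there are, for every $H\ge1$, a dimension $d_H$ and features $\Phi_H\in\mathbb R^{(\mathcal S\times\mathcal A)\times d_H}$, with zero rows at the terminal state, such that: 1. for every $H\ge1$: $d_H\le C\,H^2/\varepsilon^2$; $|(I-\Phi_H\Phi_H^{T})_{xy}|\le\varepsilon$ for all pairs $x,y$ of non-terminal state-action pairs; and for all $s^*,a^*$ there is a $w$ with $\|Q^*-\Phi_Hw\|_\infty\le\varepsilon$; 2. for every $\bar p\in(0,\tfrac12)$ and every accuracy $\eta\in(0,1)$ (for instance $\eta=\varepsilon$) there is a $c>0$, depending only on $\varepsilon,\gamma,\bar p,\eta$ and the chosen family $(\Phi_H)_{H}$, such that for every $H\ge1$, all $s^*,a^*$, all sequences of policies with $\pi_k(a\mid s)\ge\bar p$ for all $k,s,a$ ($\pi_k$ may depend in any way on the iterates), both choices of $\mu_k$, and every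 run $w_0,w_1,\dots$ of the algorithm on $M_H(\gamma,s^*,a^*)$ with features $\Phi_H$ whose initialization is not already $\eta$-accurate, $\|Q_{w_0}-Q^*\|_\infty>\eta$ (for instance $w_0=0$): $$\|Q_{w_K}-Q^*\|_\infty\le\eta\ \Longrightarrow\ K\ \ge\ c\,\gamma^{-H}.$$ That is, $\Omega(\gamma^{-H})$ exact Bellman projection steps are needed to reach an $\eta$-accurate Q-function, if one is reached at all. -/

import Mathlib

noncomputable section

/-- A finite discounted Markov decision process `(S, A, T, r, γ)` with initial
state distribution `ρ`. -/
structure FiniteMDP (S A : Type) [Fintype S] [Fintype A] where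
  /-- `T s a s'` is the probability of moving from `s` to `s'` under action `a`. -/
  T : S → A → S → ℝ
  T_nonneg : ∀ s a s', 0 ≤ T s a s'
  T_sum : ∀ s a, ∑ s', T s a s' = 1
  /-- The reward function. -/
  r : S → A → ℝ
  /-- The initial state distribution. -/
  ρ : S → ℝ
  ρ_nonneg : ∀ s, 0 ≤ ρ s
  ρ_sum : ∑ s, ρ s = 1
  /-- The discount factor. -/
  γ : ℝ
  γ_pos : 0 < γ
  γ_lt_one : γ < 1

/-- A stationary stochastic policy; `prob s a` is `π(a | s)`. -/
structure Policy (S A : Type) [Fintype A] where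
  prob : S → A → ℝ
  prob_nonneg : ∀ s a, 0 ≤ prob s a
  prob_sum : ∀ s, ∑ a, prob s a = 1

namespace FiniteMDP

variable {S A : Type} [Fintype S] [Fintype A]

/-- The Bellman optimality operator
`(B* Q)(s, a) = r(s, a) + γ E_{s' ~ T(· | s, a)} [max_{a'} Q(s', a')]`. -/
def bellman (M : FiniteMDP S A) (Q : S × A → ℝ) : S × A → ℝ :=
  fun x => M.r x.1 x.2 + M.γ * ∑ s', M.T x.1 x.2 s' * ⨆ a', Q (s', a')

theorem abs_iSup_sub_iSup_le [Nonempty A] (Q Q' : S × A → ℝ) (s : S) :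
    |(⨆ a, Q (s, a)) - ⨆ a, Q' (s, a)| ≤ dist Q Q' := by
  have key : ∀ P P' : S × A → ℝ, (⨆ a, P (s, a)) ≤ (⨆ a, P' (s, a)) + dist P P' := by
    intro P P'
    refine ciSup_le fun a => ?_
    have h1 : P' (s, a) ≤ ⨆ a, P' (s, a) :=
      le_ciSup (f := fun a => P' (s, a)) (Set.finite_range _).bddAbove a
    have h2 : |P (s, a) - P' (s, a)| ≤ dist P P' := dist_le_pi_dist P P' (s, a)
    have h3 := (abs_le.mp h2).2
    linarith
  have h1 := key Q Q'
  have h2 := key Q' Q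
  rw [dist_comm] at h2
  exact abs_le.mpr ⟨by linarith, by linarith⟩

/-- The Bellman optimality operator is a `γ`-contraction in the sup norm. -/
theorem bellman_contracting [Nonempty A] (M : FiniteMDP S A) :
    ContractingWith ⟨M.γ, M.γ_pos.le⟩ M.bellman := by
  refine ⟨by exact_mod_cast M.γ_lt_one, LipschitzWith.of_dist_le_mul fun Q Q' => ?_⟩
  refine (dist_pi_le_iff (mul_nonneg M.γ_pos.le dist_nonneg)).mpr fun x => ?_
  have h : M.bellman Q x - M.bellman Q' x =
      M.γ * ∑ s', M.T x.1 x.2 s' * ((⨆ a', Q (s', a')) - ⨆ a', Q' (s', a')) := by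
    simp only [bellman, mul_sub, Finset.sum_sub_distrib]
    ring
  rw [Real.dist_eq, h, abs_mul, abs_of_pos M.γ_pos]
  refine mul_le_mul_of_nonneg_left ?_ M.γ_pos.le
  calc |∑ s', M.T x.1 x.2 s' * ((⨆ a', Q (s', a')) - ⨆ a', Q' (s', a'))|
      ≤ ∑ s', |M.T x.1 x.2 s' * ((⨆ a', Q (s', a')) - ⨆ a', Q' (s', a'))| :=
        Finset.abs_sum_le_sum_abs _ _
    _ ≤ ∑ s', M.T x.1 x.2 s' * dist Q Q' := by
        refine Finset.sum_le_sum fun s' _ => ?_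
        rw [abs_mul, abs_of_nonneg (M.T_nonneg _ _ _)]
        exact mul_le_mul_of_nonneg_left (abs_iSup_sub_iSup_le Q Q' s') (M.T_nonneg _ _ _)
    _ = dist Q Q' := by rw [← Finset.sum_mul, M.T_sum, one_mul]

/-- The optimal Q-function: the unique fixed point of the Bellman optimality operator. -/
def Qstar [Nonempty A] (M : FiniteMDP S A) : S × A → ℝ :=
  ContractingWith.fixedPoint M.bellman M.bellman_contracting

/-- The law of the state at time `t` when following `π`. -/
def stateLaw (M : FiniteMDP S A) (π : Policy S A) : ℕ → S → ℝ
  | 0 => M.ρ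
  | t + 1 => fun s' => ∑ s, ∑ a, M.stateLaw π t s * π.prob s a * M.T s a s'

/-- The discounted state-action marginal
`d^π(s, a) = (1 - γ) ∑_t γ^t P^π(s_t = s) π(a | s)`. -/
def occupancy (M : FiniteMDP S A) (π : Policy S A) : S × A → ℝ :=
  fun x => ((1 - M.γ) * ∑' t, M.γ ^ t * M.stateLaw π t x.1) * π.prob x.1 x.2

/-- On-policy data: at iteration `k` the data distribution is `d^{π_k}`. -/
def onPolicyData (M : FiniteMDP S A) (π : ℕ → Policy S A) (k : ℕ) : S × A → ℝ :=
  M.occupancy (π k)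

/-- Replay-buffer data: at iteration `k` the data distribution is the uniform mixture of
`d^{π_0}, …, d^{π_k}`. -/
def replayData (M : FiniteMDP S A) (π : ℕ → Policy S A) (k : ℕ) : S × A → ℝ :=
  fun x => (1 / ((k : ℝ) + 1)) * ∑ i ∈ Finset.range (k + 1), M.occupancy (π i) x

/-- The linear Q-function `Q_w(s, a) = ⟨φ(s, a), w⟩`, where `φ(s, a)` is the row `(s, a)`
of `Φ`. -/
def linearQ {d : ℕ} (Φ : Matrix (S × A) (Fin d) ℝ) (w : Fin d → ℝ) : S × A → ℝ :=
  Φ.mulVec w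

/-- The squared loss `E_{(s, a) ~ μ} [(Q(s, a) - Y(s, a))²]`. -/
def sqLoss (μ : S × A → ℝ) (Q Y : S × A → ℝ) : ℝ :=
  ∑ x, μ x * (Q x - Y x) ^ 2

/-- `Q_w` is a projection, in `μ`-weighted least squares, of the target `Y` onto the
linear function class given by `Φ`. -/
def IsProjection {d : ℕ} (Φ : Matrix (S × A) (Fin d) ℝ) (μ Y : S × A → ℝ)
    (w : Fin d → ℝ) : Prop :=
  ∀ w' : Fin d → ℝ, sqLoss μ (linearQ Φ w) Y ≤ sqLoss μ (linearQ Φ w') Y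

/-- `w 0, w 1, …` are the weights produced by exact projected fitted Q-iteration with data
distributions `μ 0, μ 1, …`, that is, `Q_{w (k+1)} = Π_{μ k} (B* Q_{w k})`. -/
def IsFittedQRun (M : FiniteMDP S A) {d : ℕ} (Φ : Matrix (S × A) (Fin d) ℝ)
    (μ : ℕ → S × A → ℝ) (w : ℕ → Fin d → ℝ) : Prop :=
  ∀ k, IsProjection Φ (μ k) (M.bellman (linearQ Φ (w k))) (w (k + 1))

end FiniteMDP

/-- The `2 ^ H` states of the tree MDP with `H` levels. State `0` is the absorbing terminal
state; the states `1, …, 2 ^ H - 1` are the nodes of the full binary tree with `H` levels in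
breadth-first numbering: `1` is the root and the children of `i` are `2 * i` and
`2 * i + 1`. -/
abbrev TreeState (H : ℕ) : Type := Fin (2 ^ H)

/-- The terminal state. -/
def treeTerminal (H : ℕ) : TreeState H := ⟨0, Nat.two_pow_pos H⟩

/-- The root of the tree (for `H ≥ 1` this is state `1`). -/
def treeRoot (H : ℕ) : TreeState H := ⟨1 % 2 ^ H, Nat.mod_lt _ (Nat.two_pow_pos H)⟩

/-- The leaves, that is, the nodes of the last level: those without children. -/
def IsTreeLeaf {H : ℕ} (s : TreeState H) : Prop := 2 ^ H ≤ 2 * s.val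

/-- Deterministic transitions: action `0` leads to the left child and action `1` to the right
child; at a leaf every action ends the episode; the terminal state is absorbing. -/
def treeNext {H : ℕ} (s : TreeState H) (a : Fin 2) : TreeState H :=
  if h : s.val ≠ 0 ∧ 2 * s.val + a.val < 2 ^ H then ⟨2 * s.val + a.val, h.2⟩
  else treeTerminal H

/-- The tree MDP with discount `γ`: episodes start at the root, and the only nonzero reward is
a reward of `1` for taking action `aStar` at `sStar`. -/
def treeMDP (H : ℕ) (γ : ℝ) (hγ0 : 0 < γ) (hγ1 : γ < 1) (sStar : TreeState H)
    (aStar : Fin 2) : FiniteMDP (TreeState H) (Fin 2) where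
  T s a s' := if s' = treeNext s a then 1 else 0
  T_nonneg s a s' := by split_ifs <;> norm_num
  T_sum s a := by simp
  r s a := if s = sStar ∧ a = aStar then 1 else 0
  ρ s := if s = treeRoot H then 1 else 0
  ρ_nonneg s := by split_ifs <;> norm_num
  ρ_sum := by simp
  γ := γ
  γ_pos := hγ0
  γ_lt_one := hγ1

/-- `Φ` is an `ε`-approximate factorization of the identity on the state-action pairs of the
tree, `‖I - Φ Φᵀ‖_∞ ≤ ε` with the entrywise maximum norm; the features of the terminal state,
whose value is known to be zero, vanish. -/
def IsEpsRankFeatures {H d : ℕ} (ε : ℝ) (Φ : Matrix (TreeState H × Fin 2) (Fin d) ℝ) : Prop :=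
  (∀ a j, Φ (treeTerminal H, a) j = 0) ∧
  ∀ x y : TreeState H × Fin 2, x.1 ≠ treeTerminal H → y.1 ≠ treeTerminal H →
    |((1 : Matrix (TreeState H × Fin 2) (TreeState H × Fin 2) ℝ) - Φ * Φ.transpose) x y| ≤ ε

end

open FiniteMDP

/-! The bound holds because, for large `H`, no projection step ever yields an `η`-accurate
Q-function. The features keep the levels of the tree in separate blocks of columns, so the leaf
level is fitted on its own, and its targets do not depend on the previous iterate: they form the
indicator of the rewarded pair `m`. Let `u` be the fitted leaf block, `f n = ⟨ψ n, u⟩`, and `P n`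
the probability of reaching pair `n`. The normal equation tested against `u` itself reads `∑ P n * f
n ^ 2 = P m * f m`.

Each group of `2 ^ D` consecutive vectors `ψ n` is an orthonormal basis, and the bottom pairs below
a node at height `D` form such a group. Within it, exploration keeps every `P n` at least `p ^ D`
times the mass of that node. Parseval then bounds the left side below by `p ^ D * ‖u‖ ^ 2`, hence by
`p ^ D * f m ^ 2`. Since `P m ≤ (1 - p) ^ H`, this gives `p ^ D * f m ≤ (1 - p) ^ H`
(`linearQ_rewarded_le`). With `2 ^ D = O(H / ε ^ 2)` the factor `p ^ D` is only polynomially small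
in `H`, so `f m` tends to `0`, whereas `Q*` equals `1` there. The finitely many remaining `H` are
absorbed in the constant `c`.

Such vectors come from Hadamard bases multiplied by sign vectors, chosen greedily by an
exponential-moment argument (`exists_isBlockFrame`). -/

/-! ### Nearly orthonormal frames built from modulated Hadamard bases. -/

open Finset in
theorem exists_hadamard (D : ℕ) : ∃ M : Fin (2 ^ D) → Fin (2 ^ D) → ℝ,
    (∀ i j, M i j * M i j = 1) ∧
    ∀ b c, b ≠ c → ∑ i, M b i * M c i = 0 := by
  classical
  let e : (Fin D → Bool) ≃ Fin (2 ^ D) := Fintype.equivFinOfCardEq (by simp)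
  let χ : Bool → Bool → ℝ := fun b x => if b && x then -1 else 1
  have hχ : ∀ b x, χ b x * χ b x = 1 := by
    intro b x; cases b <;> cases x <;> simp [χ]
  refine ⟨fun b x => ∏ i, χ (e.symm b i) (e.symm x i), fun b x => ?_, fun b c hbc => ?_⟩
  · rw [← prod_mul_distrib]
    exact prod_eq_one fun i _ => hχ _ _
  · rw [← e.sum_comp]
    simp only [Equiv.symm_apply_apply, ← prod_mul_distrib]
    -- The rows are the characters of `(ℤ/2)^D`, so the inner product factors over coordinates; a
    -- coordinate where the two indices differ contributes `1 + (-1) = 0`.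
    have h := (Finset.prod_univ_sum (fun _ : Fin D => (univ : Finset Bool))
      (fun i x => χ (e.symm b i) x * χ (e.symm c i) x)).symm
    rw [Fintype.piFinset_univ] at h
    rw [h]
    obtain ⟨i, hi⟩ : ∃ i, e.symm b i ≠ e.symm c i := by
      by_contra! hcon
      exact hbc (e.symm.injective (funext hcon))
    refine prod_eq_zero (mem_univ i) ?_
    rw [Fintype.sum_bool]
    revert hi
    generalize e.symm b i = u
    generalize e.symm c i = v
    cases u <;> cases v <;> simp [χ]

/-- Some sign vector has small correlation with each of finitely many sign vectors. -/
theorem exists_sign_vector {ι κ : Type*} [Fintype ι] (S : Finset κ) (s : κ → ι → ℝ)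
    (hs : ∀ k i, s k i * s k i = 1) (ε : ℝ) (hε : 0 < ε)
    (hS : 2 * (S.card : ℝ) < Real.exp (ε ^ 2 * (Fintype.card ι : ℝ) / 2)) :
    ∃ x : ι → ℝ, (∀ i, x i * x i = 1) ∧
      ∀ k ∈ S, |∑ i, x i * s k i| ≤ ε * (Fintype.card ι : ℝ) := by
  classical
  let σ : Bool → ℝ := fun b => if b then 1 else -1
  by_contra! hcon
  set N : ℝ := ((Fintype.card ι : ℕ) : ℝ) with hN
  -- Chernoff at parameter `±ε`: a violated correlation makes one of the two exponentials at least
  -- `exp (ε ^ 2 * N)`. Summing over all `x` and comparing with the moment bound contradicts `hS`.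
  have hbad : ∀ x : ι → Bool, Real.exp (ε ^ 2 * N) ≤
      ∑ k ∈ S, (Real.exp (ε * ∑ i, σ (x i) * s k i) +
        Real.exp (-ε * ∑ i, σ (x i) * s k i)) := by
    intro x
    obtain ⟨k, hk, h⟩ := hcon (fun i => σ (x i)) (fun i => by cases x i <;> simp [σ])
    refine le_trans ?_ (Finset.single_le_sum
      (f := fun k => Real.exp (ε * ∑ i, σ (x i) * s k i) +
        Real.exp (-ε * ∑ i, σ (x i) * s k i)) (fun _ _ => by positivity) hk)
    rcases lt_abs.mp h with h | h
    · refine le_add_of_le_of_nonneg (Real.exp_le_exp.mpr ?_) (Real.exp_pos _).le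
      nlinarith
    · refine le_add_of_nonneg_of_le (Real.exp_pos _).le (Real.exp_le_exp.mpr ?_)
      nlinarith
  have hmgf : ∀ (t : ℝ) (k : κ), t ^ 2 = ε ^ 2 →
      ∑ x : ι → Bool, Real.exp (t * ∑ i, σ (x i) * s k i) ≤
        2 ^ Fintype.card ι * Real.exp (ε ^ 2 * N / 2) := by
    intro t k ht
    have h := (Finset.prod_univ_sum (fun _ : ι => (Finset.univ : Finset Bool))
      (fun i b => Real.exp (t * (σ b * s k i)))).symm
    rw [Fintype.piFinset_univ] at h
    simp only [Finset.mul_sum, Real.exp_sum]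
    rw [h]
    calc ∏ i, ∑ b, Real.exp (t * (σ b * s k i))
        ≤ ∏ _i : ι, (2 * Real.exp (ε ^ 2 / 2)) := by
          refine Finset.prod_le_prod (fun i _ => by positivity) fun i _ => ?_
          have h1 := Real.cosh_le_exp_half_sq (t * s k i)
          rw [Real.cosh_eq] at h1
          have h2 : (t * s k i) ^ 2 = ε ^ 2 := by
            have := hs k i
            calc (t * s k i) ^ 2 = t ^ 2 * (s k i * s k i) := by ring
              _ = ε ^ 2 := by rw [this, ht, mul_one]
          rw [h2] at h1
          simp only [Fintype.sum_bool, σ]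
          simp only [if_true, Bool.false_eq_true, if_false, one_mul, neg_mul, mul_neg]
          linarith
      _ = 2 ^ Fintype.card ι * Real.exp (ε ^ 2 * N / 2) := by
          rw [Finset.prod_const, mul_pow, ← Real.exp_nat_mul, Finset.card_univ]
          congr 2
          simp only [N]
          ring
  have h1 : (2 : ℝ) ^ Fintype.card ι * Real.exp (ε ^ 2 * N) ≤
      ∑ x : ι → Bool, ∑ k ∈ S, (Real.exp (ε * ∑ i, σ (x i) * s k i) +
        Real.exp (-ε * ∑ i, σ (x i) * s k i)) := by
    have := Finset.sum_le_sum fun (x : ι → Bool) (_ : x ∈ Finset.univ) => hbad x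
    simpa using this
  rw [Finset.sum_comm] at h1
  have h2 : ∑ k ∈ S, ∑ x : ι → Bool, (Real.exp (ε * ∑ i, σ (x i) * s k i) +
        Real.exp (-ε * ∑ i, σ (x i) * s k i)) ≤
      ∑ _k ∈ S, 2 * (2 ^ Fintype.card ι * Real.exp (ε ^ 2 * N / 2)) := by
    refine Finset.sum_le_sum fun k _ => ?_
    rw [Finset.sum_add_distrib, two_mul]
    exact add_le_add (hmgf _ _ rfl) (hmgf _ _ (by ring))
  rw [Finset.sum_const, nsmul_eq_mul] at h2
  have h3 : Real.exp (ε ^ 2 * N) =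
      Real.exp (ε ^ 2 * N / 2) * Real.exp (ε ^ 2 * N / 2) := by
    rw [← Real.exp_add]; congr 1; ring
  rw [h3] at h1
  set E := Real.exp (ε ^ 2 * N / 2)
  have hE : 0 < E := Real.exp_pos _
  have h2N : (0 : ℝ) < 2 ^ Fintype.card ι := by positivity
  have h4 : (2 ^ Fintype.card ι * E) * (2 * (S.card : ℝ)) < (2 ^ Fintype.card ι * E) * E :=
    mul_lt_mul_of_pos_left hS (by positivity)
  nlinarith

/-- Greedy choice of sign vectors that modulate the rows of `M` to nearly orthogonal vectors. -/
theorem exists_modulations {N m : ℕ} (M : ℕ → Fin N → ℝ)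
    (hM : ∀ n i, M n i * M n i = 1) (ε : ℝ) (hε : 0 < ε)
    (hm : 2 * ((m : ℝ) * m) < Real.exp (ε ^ 2 * N / 2)) (L : ℕ) :
    ∃ g : ℕ → Fin N → ℝ, (∀ l i, g l i * g l i = 1) ∧
      ∀ a < m, ∀ b < m, a / N < b / N → b / N < L →
        |∑ i, (g (a / N) i * M a i) * (g (b / N) i * M b i)| ≤ ε * N := by
  induction L with
  | zero => exact ⟨fun _ _ => 1, by simp, by simp⟩
  | succ L ih =>
    obtain ⟨g, hg, hgm⟩ := ih
    -- The unknown modulation enters each new inner product linearly, as the correlation of `x` with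
    -- the sign vector `g (a / N) * M a * M b`. Hence at most `m * m` constraints at each stage.
    obtain ⟨x, hx, hxs⟩ := exists_sign_vector (ι := Fin N) (Finset.range m ×ˢ Finset.range m)
      (fun ab i => g (ab.1 / N) i * M ab.1 i * M ab.2 i)
      (fun ab i => by
        calc g (ab.1 / N) i * M ab.1 i * M ab.2 i * (g (ab.1 / N) i * M ab.1 i * M ab.2 i)
            = (g (ab.1 / N) i * g (ab.1 / N) i) * (M ab.1 i * M ab.1 i) *
              (M ab.2 i * M ab.2 i) := by ring
          _ = 1 := by simp [hg, hM]) ε hε (by simpa using hm)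
    refine ⟨Function.update g L x, fun l i => ?_, fun a ha b hb hab hbL => ?_⟩
    · rcases eq_or_ne l L with rfl | h
      · simpa using hx i
      · simpa [h] using hg l i
    · have haL : a / N ≠ L := by omega
      rw [Function.update_of_ne haL]
      rcases eq_or_ne (b / N) L with h | h
      · rw [h, Function.update_self]
        have := hxs (a, b) (by simp [ha, hb])
        rw [Fintype.card_fin] at this
        convert this using 3 with i
        ring
      · rw [Function.update_of_ne h]
        exact hgm a ha b hb hab (by omega)

/-- A nearly orthonormal family of vectors, each dyadic block of which is an orthonormal basis. -/
structure IsBlockFrame (ε : ℝ) (m D : ℕ) (ψ : ℕ → Fin (2 ^ D) → ℝ) : Prop where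
  unit : ∀ n, ∑ i, ψ n i * ψ n i = 1
  almost_orthogonal : ∀ a < m, ∀ b < m, a ≠ b → |∑ i, ψ a i * ψ b i| ≤ ε
  parseval : ∀ (t : ℕ) (v : Fin (2 ^ D) → ℝ),
    ∑ b ∈ Finset.range (2 ^ D), (∑ i, ψ (t * 2 ^ D + b) i * v i) ^ 2 = ∑ i, v i ^ 2

/-- Multiplying a whole Hadamard basis by one sign vector preserves its orthogonality, so only inner
products between different blocks need the greedy choice. -/
theorem exists_isBlockFrame {m D : ℕ} {ε : ℝ} (hε : 0 < ε)
    (hm : 2 * ((m : ℝ) * m) < Real.exp (ε ^ 2 * (2 ^ D : ℕ) / 2)) :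
    ∃ ψ : ℕ → Fin (2 ^ D) → ℝ, IsBlockFrame ε m D ψ := by
  have hM := exists_hadamard D
  have hpos : 0 < 2 ^ D := Nat.two_pow_pos D
  set N : ℕ := 2 ^ D with hN
  obtain ⟨M, hM1, hM⟩ := hM
  let M' : ℕ → Fin N → ℝ := fun n => M ⟨n % N, Nat.mod_lt _ hpos⟩
  -- `L = m` stages suffice, since `b / N ≤ b < m`.
  obtain ⟨g, hg, hgm⟩ := exists_modulations M' (fun n i => hM1 _ i) ε hε hm m
  have hNr : (0 : ℝ) < N := by exact_mod_cast hpos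
  have hs : (√(N : ℝ))⁻¹ * (√(N : ℝ))⁻¹ = (N : ℝ)⁻¹ := by
    rw [← mul_inv, Real.mul_self_sqrt hNr.le]
  let ψ : ℕ → Fin N → ℝ := fun n i => (√(N : ℝ))⁻¹ * (g (n / N) i * M' n i)
  have hdot : ∀ a b, ∑ i, ψ a i * ψ b i =
      (N : ℝ)⁻¹ * ∑ i, (g (a / N) i * M' a i) * (g (b / N) i * M' b i) := by
    intro a b
    rw [Finset.mul_sum, ← hs]
    exact Finset.sum_congr rfl fun i _ => by simp only [ψ]; ring
  have hunit : ∀ n, ∑ i, ψ n i * ψ n i = 1 := by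
    intro n
    rw [hdot]
    have : ∀ i, (g (n / N) i * M' n i) * (g (n / N) i * M' n i) = 1 := fun i => by
      calc _ = (g (n / N) i * g (n / N) i) * (M' n i * M' n i) := by ring
        _ = 1 := by rw [hg, hM1, one_mul]
    simp [this, hNr.ne']
  have hblock : ∀ a b, a / N = b / N → a ≠ b → ∑ i, ψ a i * ψ b i = 0 := by
    intro a b hab hne
    rw [hdot, hab]
    have : ∀ i, (g (b / N) i * M' a i) * (g (b / N) i * M' b i) = M' a i * M' b i := fun i => by
      calc _ = (g (b / N) i * g (b / N) i) * (M' a i * M' b i) := by ring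
        _ = _ := by rw [hg, one_mul]
    simp only [this]
    rw [hM, mul_zero]
    intro h
    rw [Fin.mk.injEq] at h
    apply hne
    rw [← Nat.div_add_mod a N, ← Nat.div_add_mod b N, hab, h]
  refine ⟨ψ, hunit, fun a ha b hb hne => ?_, fun t v => ?_⟩
  · rcases lt_trichotomy (a / N) (b / N) with h | h | h
    · rw [hdot, abs_mul, abs_of_pos (inv_pos.mpr hNr), inv_mul_le_iff₀ hNr, mul_comm (N : ℝ)]
      exact hgm a ha b hb h (lt_of_le_of_lt (Nat.div_le_self _ _) hb)
    · rw [hblock a b h hne, abs_zero]; exact hε.le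
    · have hc : ∑ i, ψ a i * ψ b i = ∑ i, ψ b i * ψ a i :=
        Finset.sum_congr rfl fun i _ => mul_comm _ _
      rw [hc, hdot, abs_mul, abs_of_pos (inv_pos.mpr hNr), inv_mul_le_iff₀ hNr,
        mul_comm (N : ℝ)]
      exact hgm b hb a ha h (lt_of_le_of_lt (Nat.div_le_self _ _) ha)
  · let U : Matrix (Fin N) (Fin N) ℝ := Matrix.of fun b i => ψ (t * N + b) i
    have hU : U * U.transpose = 1 := by
      ext b c
      rw [Matrix.mul_apply]
      simp only [Matrix.transpose_apply, U, Matrix.of_apply]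
      rcases eq_or_ne b c with rfl | hbc
      · rw [hunit, Matrix.one_apply_eq]
      · rw [Matrix.one_apply_ne hbc]
        have hd : ∀ b : Fin N, (t * N + b) / N = t := fun b => by
          rw [mul_comm, Nat.mul_add_div hpos, Nat.div_eq_of_lt b.2, add_zero]
        refine hblock _ _ (by rw [hd, hd]) fun h => hbc (Fin.ext (by omega))
    -- `U` is square, so orthonormal rows force orthonormal columns; this gives Parseval.
    have hU' : U.transpose * U = 1 := mul_eq_one_comm.mp hU
    rw [Finset.sum_range (fun b => (∑ i, ψ (t * N + b) i * v i) ^ 2)]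
    have h1 : (U.mulVec v) ⬝ᵥ (U.mulVec v) = v ⬝ᵥ v := by
      rw [Matrix.dotProduct_mulVec, ← Matrix.mulVec_transpose, Matrix.mulVec_mulVec, hU',
        Matrix.one_mulVec]
    simp only [dotProduct, Matrix.mulVec, U, Matrix.of_apply] at h1
    simpa only [sq] using h1

theorem exists_nearly_minimal_isBlockFrame {H : ℕ} (hH : 1 ≤ H) {ε : ℝ} (hε : 0 < ε)
    (hε1 : ε < 1) :
    ∃ (D : ℕ) (ψ : ℕ → Fin (2 ^ D) → ℝ), (2 ^ D : ℝ) ≤ 16 * H / ε ^ 2 ∧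
      IsBlockFrame ε (2 ^ (H + 1)) D ψ := by
  have hH' : (1 : ℝ) ≤ H := by exact_mod_cast hH
  have hε2 : 0 < ε ^ 2 := by positivity
  have hx : (1 : ℝ) ≤ 8 * H / ε ^ 2 := by
    rw [le_div_iff₀ hε2]; nlinarith
  -- With `D = n + 1`, `2 ^ D` lies above `8 * H / ε ^ 2` and at most at twice that. The exponent is
  -- then at least `4 * H`, and `2 * 4 ^ (H + 1) ≤ 32 ^ H < exp (4 * H)`.
  obtain ⟨n, hn1, hn2⟩ := exists_nat_pow_near hx one_lt_two
  have key : 2 * ((2 ^ (H + 1) : ℕ) * (2 ^ (H + 1) : ℕ) : ℝ) <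
      Real.exp (ε ^ 2 * (2 ^ (n + 1) : ℕ) / 2) := by
    rw [div_lt_iff₀ hε2] at hn2
    have h1 : (4 * H : ℝ) ≤ ε ^ 2 * (2 ^ (n + 1) : ℕ) / 2 := by push_cast; linarith
    refine lt_of_lt_of_le ?_ (Real.exp_le_exp.mpr h1)
    have h2 : Real.exp (4 * H) = (Real.exp 1 ^ 4) ^ H := by
      rw [← Real.exp_nat_mul, ← Real.exp_nat_mul]; congr 1; push_cast; ring
    have h3 : (32 : ℝ) < Real.exp 1 ^ 4 := by
      calc (32 : ℝ) < 2.7 ^ 4 := by norm_num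
        _ < Real.exp 1 ^ 4 := pow_lt_pow_left₀
          (lt_trans (by norm_num) Real.exp_one_gt_d9) (by norm_num) (by norm_num)
    rw [h2]
    calc 2 * ((2 ^ (H + 1) : ℕ) * (2 ^ (H + 1) : ℕ) : ℝ) = 8 * 4 ^ H := by
          push_cast
          rw [show (4 : ℝ) = 2 * 2 by norm_num, mul_pow]; ring
      _ ≤ 8 ^ H * 4 ^ H := by
          refine mul_le_mul_of_nonneg_right ?_ (by positivity)
          exact le_self_pow₀ (by norm_num) (by omega)
      _ = 32 ^ H := by rw [← mul_pow]; norm_num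
      _ < (Real.exp 1 ^ 4) ^ H := pow_lt_pow_left₀ h3 (by norm_num) (by omega)
  obtain ⟨ψ, hψ⟩ := exists_isBlockFrame (m := 2 ^ (H + 1)) (D := n + 1) hε key
  refine ⟨n + 1, ψ, ?_, hψ⟩
  rw [pow_succ]
  calc (2 : ℝ) ^ n * 2 ≤ 8 * H / ε ^ 2 * 2 := by linarith
    _ = 16 * H / ε ^ 2 := by ring

/-! ### Mass splitting on the binary tree. -/

/-- Sums over the states and actions of the tree, in breadth-first numbering of the pairs. -/
theorem sum_treeState_prod {H : ℕ} (G : ℕ → ℝ) :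
    ∑ x : TreeState H × Fin 2, G (2 * x.1.val + x.2.val) =
      ∑ n ∈ Finset.range (2 ^ (H + 1)), G n := by
  rw [Fintype.sum_prod_type]
  simp only [Fin.sum_univ_two, Fin.val_zero, Fin.val_one, add_zero]
  rw [← Finset.sum_range (fun s => G (2 * s) + G (2 * s + 1)), pow_succ]
  induction 2 ^ H with
  | zero => simp
  | succ n ih =>
    rw [Finset.sum_range_succ, ih, show (n + 1) * 2 = n * 2 + 1 + 1 by ring,
      Finset.sum_range_succ, Finset.sum_range_succ, mul_comm 2 n, add_assoc]

theorem sum_Ico_mul (F : ℕ → ℝ) (N : ℕ) {a b : ℕ} (hab : a ≤ b) :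
    ∑ n ∈ Finset.Ico (a * N) (b * N), F n =
      ∑ t ∈ Finset.Ico a b, ∑ j ∈ Finset.range N, F (t * N + j) := by
  induction b, hab using Nat.le_induction with
  | base => simp
  | succ b hb ih =>
    rw [Finset.sum_Ico_succ_top hb, ← ih,
      ← Finset.sum_Ico_consecutive F (Nat.mul_le_mul_right N hb)
        (Nat.mul_le_mul_right N (Nat.le_succ b)), Finset.sum_Ico_eq_sum_range F (b * N)]
    congr 3
    rw [Nat.succ_mul, Nat.add_sub_cancel_left]

/-- A unit mass on the nodes of the binary tree that splits, at each node before depth `H`,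
into two parts, each a fraction at least `p` of the mass of the node. -/
structure IsTreeSplitting (p : ℝ) (H : ℕ) (P : ℕ → ℝ) : Prop where
  root : P 1 = 1
  split : ∀ n, 1 ≤ n → n < 2 ^ H → P (2 * n) + P (2 * n + 1) = P n
  left : ∀ n, 1 ≤ n → n < 2 ^ H → p * P n ≤ P (2 * n)
  right : ∀ n, 1 ≤ n → n < 2 ^ H → p * P n ≤ P (2 * n + 1)

namespace IsTreeSplitting

variable {p : ℝ} {H : ℕ} {P : ℕ → ℝ}

theorem le_child (h : IsTreeSplitting p H P) {n : ℕ} (h2 : 2 ≤ n) (hn : n < 2 ^ (H + 1)) :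
    p * P (n / 2) ≤ P n := by
  have h1 : n / 2 < 2 ^ H := by rw [pow_succ] at hn; omega
  rcases Nat.even_or_odd' n with ⟨m, rfl | rfl⟩
  · rw [show 2 * m / 2 = m by omega] at *; exact h.left m (by omega) h1
  · rw [show (2 * m + 1) / 2 = m by omega] at *; exact h.right m (by omega) h1

/-- The sibling takes at least the fraction `p`. -/
theorem child_le (h : IsTreeSplitting p H P) {n : ℕ} (h2 : 2 ≤ n) (hn : n < 2 ^ (H + 1)) :
    P n ≤ (1 - p) * P (n / 2) := by
  have h1 : n / 2 < 2 ^ H := by rw [pow_succ] at hn; omega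
  rcases Nat.even_or_odd' n with ⟨m, rfl | rfl⟩
  · rw [show 2 * m / 2 = m by omega] at *
    have := h.right m (by omega) h1
    have := h.split m (by omega) h1
    linarith
  · rw [show (2 * m + 1) / 2 = m by omega] at *
    have := h.left m (by omega) h1
    have := h.split m (by omega) h1
    linarith

theorem le_pow (h : IsTreeSplitting p H P) (hp1 : p ≤ 1) {j n : ℕ} (hj : j ≤ H)
    (h1 : 2 ^ j ≤ n) (hn : n < 2 ^ (j + 1)) : P n ≤ (1 - p) ^ j := by
  induction j generalizing n with
  | zero =>
    obtain rfl : n = 1 := by simp at h1 hn; omega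
    rw [h.root, pow_zero]
  | succ j ih =>
    have hH : 2 ^ (j + 1) ≤ 2 ^ H := Nat.pow_le_pow_right (by norm_num) hj
    have e1 : 2 ^ (j + 1) = 2 * 2 ^ j := by ring
    have e2 : 2 ^ (j + 1 + 1) = 2 * 2 ^ (j + 1) := by ring
    have e3 : 2 ^ (H + 1) = 2 * 2 ^ H := by ring
    have := Nat.two_pow_pos j
    rw [pow_succ']
    exact le_trans (h.child_le (by omega) (by omega))
      (mul_le_mul_of_nonneg_left (ih (by omega) (by omega) (by omega)) (by linarith))

theorem le_descendant (h : IsTreeSplitting p H P) (hp : 0 ≤ p) {j t b : ℕ} (ht : 1 ≤ t)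
    (hb : b < 2 ^ j) (hn : t * 2 ^ j + b < 2 ^ (H + 1)) :
    p ^ j * P t ≤ P (t * 2 ^ j + b) := by
  induction j generalizing b with
  | zero =>
    obtain rfl : b = 0 := by simpa using hb
    simp
  | succ j ih =>
    have e : t * 2 ^ (j + 1) = 2 * (t * 2 ^ j) := by ring
    have e1 : 2 ^ (j + 1) = 2 * 2 ^ j := by ring
    have hpos : 1 ≤ t * 2 ^ j := Nat.mul_pos ht (Nat.two_pow_pos j)
    have hd : (t * 2 ^ (j + 1) + b) / 2 = t * 2 ^ j + b / 2 := by omega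
    have h1 := h.le_child (n := t * 2 ^ (j + 1) + b) (by omega) hn
    rw [hd] at h1
    refine le_trans ?_ h1
    rw [pow_succ', mul_assoc]
    exact mul_le_mul_of_nonneg_left (ih (by omega) (by omega)) hp

/-- Conservation of mass lets the bounds for separate bottom subtrees be added with total weight
one, so the loss is `p ^ D` and not `p ^ H`. -/
theorem sum_level (h : IsTreeSplitting p H P) {j : ℕ} (hj : j ≤ H) :
    ∑ n ∈ Finset.Ico (2 ^ j) (2 ^ (j + 1)), P n = 1 := by
  induction j with
  | zero => simp [h.root]
  | succ j ih =>
    have hle : 2 ^ j ≤ 2 ^ (j + 1) := Nat.pow_le_pow_right (by norm_num) (by omega)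
    have hH : 2 ^ (j + 1) ≤ 2 ^ H := Nat.pow_le_pow_right (by norm_num) hj
    rw [pow_succ 2 (j + 1), pow_succ 2 j, sum_Ico_mul P 2 (by rw [← pow_succ]; exact hle),
      ← pow_succ, ← ih (by omega)]
    refine Finset.sum_congr rfl fun n hn => ?_
    rw [Finset.mem_Ico] at hn
    have := Nat.two_pow_pos j
    rw [Finset.sum_range_succ, Finset.sum_range_one, mul_comm n 2]
    exact h.split n (by omega) (by omega)

/-- The conditions are linear in the mass, so they survive mixing; this reduces the replay buffer to
the on-policy case. -/
theorem average {Q : ℕ → ℕ → ℝ} (h : ∀ i, IsTreeSplitting p H (Q i)) (k : ℕ) :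
    IsTreeSplitting p H fun n => (1 / ((k : ℝ) + 1)) * ∑ i ∈ Finset.range (k + 1), Q i n := by
  have hk : (0 : ℝ) < (k : ℝ) + 1 := by positivity
  refine ⟨?_, fun n h1 hn => ?_, fun n h1 hn => ?_, fun n h1 hn => ?_⟩
  · simp only [(h _).root]
    simp only [Finset.sum_const, Finset.card_range, nsmul_eq_mul, mul_one]
    push_cast
    field_simp
  · rw [← mul_add, ← Finset.sum_add_distrib]
    simp only [(h _).split n h1 hn]
  · rw [mul_left_comm, Finset.mul_sum]
    exact mul_le_mul_of_nonneg_left (Finset.sum_le_sum fun i _ => (h i).left n h1 hn)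
      (by positivity)
  · rw [mul_left_comm, Finset.mul_sum]
    exact mul_le_mul_of_nonneg_left (Finset.sum_le_sum fun i _ => (h i).right n h1 hn)
      (by positivity)

end IsTreeSplitting

/-! ### Path probabilities, occupancies and `Q*` in the tree MDP. -/

/-- The probability that `π` follows the path from the root to node `n` of the binary tree. -/
noncomputable def Policy.pathProb {H : ℕ} (π : Policy (TreeState H) (Fin 2)) (n : ℕ) : ℝ :=
  if n ≤ 1 then 1
  else π.pathProb (n / 2) *
    if h : n / 2 < 2 ^ H then π.prob ⟨n / 2, h⟩ ⟨n % 2, Nat.mod_lt _ two_pos⟩ else 0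
termination_by n
decreasing_by omega

theorem Policy.pathProb_one {H : ℕ} (π : Policy (TreeState H) (Fin 2)) : π.pathProb 1 = 1 := by
  rw [Policy.pathProb]; simp

theorem Policy.pathProb_child {H : ℕ} (π : Policy (TreeState H) (Fin 2)) (s : TreeState H)
    (a : Fin 2) (hs : s.val ≠ 0) :
    π.pathProb (2 * s.val + a.val) = π.pathProb s.val * π.prob s a := by
  have h1 : (2 * s.val + a.val) / 2 = s.val := by omega
  have h2 : (2 * s.val + a.val) % 2 = a.val := by omega
  rw [Policy.pathProb, if_neg (by omega)]
  simp only [h1, h2, s.isLt, dif_pos]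

theorem Policy.isTreeSplitting_pathProb {H : ℕ} (π : Policy (TreeState H) (Fin 2)) {p : ℝ}
    (hπ : ∀ s a, p ≤ π.prob s a) : IsTreeSplitting p H π.pathProb := by
  have h0 : ∀ n, 0 ≤ π.pathProb n := by
    intro n
    induction n using Nat.strong_induction_on with
    | _ n ih =>
      rw [Policy.pathProb]
      split_ifs
      · exact zero_le_one
      · exact mul_nonneg (ih _ (by omega)) (π.prob_nonneg _ _)
      · simp
  have hl : ∀ (n : ℕ) (hn : n < 2 ^ H), 1 ≤ n →
      π.pathProb (2 * n) = π.pathProb n * π.prob ⟨n, hn⟩ 0 := fun n hn h1 =>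
    π.pathProb_child ⟨n, hn⟩ 0 (by simp; omega)
  have hr : ∀ (n : ℕ) (hn : n < 2 ^ H), 1 ≤ n →
      π.pathProb (2 * n + 1) = π.pathProb n * π.prob ⟨n, hn⟩ 1 := fun n hn h1 =>
    π.pathProb_child ⟨n, hn⟩ 1 (by simp; omega)
  refine ⟨π.pathProb_one, fun n h1 hn => ?_, fun n h1 hn => ?_, fun n h1 hn => ?_⟩
  · rw [hl n hn h1, hr n hn h1, ← mul_add, ← Fin.sum_univ_two (fun a => π.prob ⟨n, hn⟩ a),
      π.prob_sum, mul_one]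
  · rw [hl n hn h1, mul_comm]
    exact mul_le_mul_of_nonneg_left (hπ _ _) (h0 n)
  · rw [hr n hn h1, mul_comm]
    exact mul_le_mul_of_nonneg_left (hπ _ _) (h0 n)

section TreeMDP

variable {H : ℕ} {γ : ℝ} (hγ0 : 0 < γ) (hγ1 : γ < 1) (sStar : TreeState H) (aStar : Fin 2)

theorem treeNext_val {s : TreeState H} {a : Fin 2} (hs : s.val ≠ 0)
    (h : 2 * s.val + a.val < 2 ^ H) : (treeNext s a).val = 2 * s.val + a.val := by
  rw [treeNext, dif_pos ⟨hs, h⟩]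

theorem eq_treeTerminal_iff {s : TreeState H} : s = treeTerminal H ↔ s.val = 0 := by
  rw [treeTerminal, Fin.ext_iff]

theorem treeNext_eq_treeTerminal {s : TreeState H} {a : Fin 2}
    (h : ¬ (s.val ≠ 0 ∧ 2 * s.val + a.val < 2 ^ H)) : treeNext s a = treeTerminal H := by
  rw [treeNext, dif_neg h]

theorem eq_treeNext_iff {s s' : TreeState H} {a : Fin 2} (hs' : 2 ≤ s'.val) :
    s' = treeNext s a ↔ s.val = s'.val / 2 ∧ a.val = s'.val % 2 := by
  have := s'.isLt
  have := a.isLt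
  by_cases h : s.val ≠ 0 ∧ 2 * s.val + a.val < 2 ^ H
  · rw [Fin.ext_iff, treeNext_val h.1 h.2]
    omega
  · rw [treeNext_eq_treeTerminal h, eq_treeTerminal_iff]
    omega

theorem stateLaw_treeMDP (π : Policy (TreeState H) (Fin 2)) (t : ℕ) (s : TreeState H)
    (hs : s.val ≠ 0) :
    (treeMDP H γ hγ0 hγ1 sStar aStar).stateLaw π t s =
      if t = Nat.log 2 s.val then π.pathProb s.val else 0 := by
  have hsH := s.isLt
  induction t generalizing s with
  | zero =>
    have h1 : 1 % 2 ^ H = 1 := Nat.mod_eq_of_lt (by omega)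
    simp only [stateLaw, treeMDP, treeRoot, Fin.ext_iff, h1, eq_comm (a := 0),
      Nat.log_eq_zero_iff]
    by_cases h : s.val = 1
    · simp [h, π.pathProb_one]
    · rw [if_neg h, if_neg (by omega)]
  | succ t ih =>
    simp only [stateLaw]
    rcases Nat.lt_or_ge s.val 2 with h2 | h2
    · rw [if_neg (by rw [Nat.log_of_lt h2]; omega)]
      refine Finset.sum_eq_zero fun s' _ => Finset.sum_eq_zero fun a _ => ?_
      rw [show (treeMDP H γ hγ0 hγ1 sStar aStar).T s' a s =
        if s = treeNext s' a then 1 else 0 from rfl, if_neg, mul_zero]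
      intro h
      by_cases hc : s'.val ≠ 0 ∧ 2 * s'.val + a.val < 2 ^ H
      · rw [Fin.ext_iff, treeNext_val hc.1 hc.2] at h
        omega
      · rw [treeNext_eq_treeTerminal hc, eq_treeTerminal_iff] at h
        omega
    -- A node other than the root has exactly one incoming edge, so the double sum collapses to one
    -- term.
    · let s₀ : TreeState H := ⟨s.val / 2, by omega⟩
      let a₀ : Fin 2 := ⟨s.val % 2, Nat.mod_lt _ two_pos⟩
      have hT : ∀ s' a, (treeMDP H γ hγ0 hγ1 sStar aStar).T s' a s =
          if s' = s₀ ∧ a = a₀ then 1 else 0 := by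
        intro s' a
        rw [show (treeMDP H γ hγ0 hγ1 sStar aStar).T s' a s =
          if s = treeNext s' a then 1 else 0 from rfl]
        simp only [eq_treeNext_iff h2, Fin.ext_iff, s₀, a₀]
      simp only [hT]
      rw [Finset.sum_eq_single s₀, Finset.sum_eq_single a₀]
      · have hs0 : s₀.val ≠ 0 := by simp only [s₀]; omega
        have hval : 2 * s₀.val + a₀.val = s.val := by simp only [s₀, a₀]; omega
        have hlog : Nat.log 2 s.val = Nat.log 2 s₀.val + 1 :=
          Nat.log_of_one_lt_of_le (by norm_num) h2
        rw [ih s₀ hs0 s₀.isLt, hlog, ← hval, π.pathProb_child s₀ a₀ hs0]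
        simp only [Nat.add_right_cancel_iff, and_self, if_true, mul_one, ite_mul, zero_mul]
      · intro a _ ha; simp [ha]
      · simp
      · intro s' _ hs'; simp [hs']
      · simp

/-- A non-terminal state can be visited only at the time equal to its depth, so one term of the
series survives. -/
theorem occupancy_treeMDP (π : Policy (TreeState H) (Fin 2)) (s : TreeState H) (a : Fin 2)
    (hs : s.val ≠ 0) :
    (treeMDP H γ hγ0 hγ1 sStar aStar).occupancy π (s, a) =
      (1 - γ) * γ ^ Nat.log 2 s.val * π.pathProb (2 * s.val + a.val) := by
  rw [occupancy, π.pathProb_child s a hs]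
  simp only [stateLaw_treeMDP hγ0 hγ1 sStar aStar π _ s hs]
  rw [tsum_eq_single (Nat.log 2 s.val) (fun t ht => by rw [if_neg ht, mul_zero]), if_pos rfl]
  change (1 - γ) * (γ ^ _ * _) * _ = _
  ring

theorem exists_isTreeSplitting_data {π : ℕ → Policy (TreeState H) (Fin 2)} {p : ℝ}
    (hπ : ∀ k s a, p ≤ (π k).prob s a) {μ : ℕ → TreeState H × Fin 2 → ℝ}
    (hμ : μ = (treeMDP H γ hγ0 hγ1 sStar aStar).onPolicyData π ∨
      μ = (treeMDP H γ hγ0 hγ1 sStar aStar).replayData π) (k : ℕ) :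
    ∃ P, IsTreeSplitting p H P ∧ ∀ (s : TreeState H) (a : Fin 2), s.val ≠ 0 →
      μ k (s, a) = (1 - γ) * γ ^ Nat.log 2 s.val * P (2 * s.val + a.val) := by
  have hP := fun i => (π i).isTreeSplitting_pathProb (hπ i)
  rcases hμ with rfl | rfl
  · exact ⟨_, hP k, fun s a hs => occupancy_treeMDP hγ0 hγ1 sStar aStar (π k) s a hs⟩
  · refine ⟨_, IsTreeSplitting.average hP k, fun s a hs => ?_⟩
    simp only [replayData, occupancy_treeMDP hγ0 hγ1 sStar aStar _ s a hs, ← Finset.mul_sum]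
    ring

theorem bellman_treeMDP (Q : TreeState H × Fin 2 → ℝ) (s : TreeState H) (a : Fin 2) :
    (treeMDP H γ hγ0 hγ1 sStar aStar).bellman Q (s, a) =
      (if s = sStar ∧ a = aStar then 1 else 0) + γ * ⨆ a', Q (treeNext s a, a') := by
  simp [bellman, treeMDP]

theorem iSup_fin_two (f : Fin 2 → ℝ) : ⨆ a, f a = max (f 0) (f 1) := by
  apply le_antisymm
  · refine ciSup_le fun a => ?_
    fin_cases a
    · exact le_max_left _ _
    · exact le_max_right _ _
  · exact max_le (le_ciSup (Set.finite_range f).bddAbove 0)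
      (le_ciSup (Set.finite_range f).bddAbove 1)

/-- `Q*` is supported on the path to the rewarded pair. -/
theorem Qstar_treeMDP (hleaf : IsTreeLeaf sStar) (s : TreeState H) (a : Fin 2) :
    (treeMDP H γ hγ0 hγ1 sStar aStar).Qstar (s, a) =
      if s.val ≠ 0 ∧ 2 * s.val + a.val =
          (2 * sStar.val + aStar.val) / 2 ^ (H - 1 - Nat.log 2 s.val)
        then γ ^ (H - 1 - Nat.log 2 s.val) else 0 := by
  set M := treeMDP H γ hγ0 hγ1 sStar aStar
  set m := 2 * sStar.val + aStar.val with hm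
  -- Dividing the number of the rewarded pair by a power of two gives its ancestor on the given
  -- level.
  let q : TreeState H × Fin 2 → ℝ := fun x =>
    if x.1.val ≠ 0 ∧ 2 * x.1.val + x.2.val = m / 2 ^ (H - 1 - Nat.log 2 x.1.val)
        then γ ^ (H - 1 - Nat.log 2 x.1.val) else 0
  suffices hq : M.bellman q = q by
    have : q = M.Qstar := M.bellman_contracting.fixedPoint_unique hq
    exact congrFun this.symm (s, a)
  have hqT : ⨆ a, q (treeTerminal H, a) = 0 := by
    simp [q, treeTerminal]
  funext ⟨s, a⟩
  rw [bellman_treeMDP]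
  have hsH := s.isLt
  have hsS := sStar.isLt
  have ha := a.isLt
  have haS := aStar.isLt
  have hl : 2 ^ H ≤ 2 * sStar.val := hleaf
  have hHpos := Nat.two_pow_pos H
  by_cases hs : s.val = 0
  · rw [treeNext_eq_treeTerminal (by simp [hs]), hqT, if_neg (by rw [Fin.ext_iff]; omega),
      show q (s, a) = 0 from if_neg fun h => h.1 hs, mul_zero, add_zero]
  have hHne : H ≠ 0 := by
    rintro rfl
    simp at hsH
    omega
  obtain ⟨G, rfl⟩ : ∃ G, H = G + 1 := ⟨H - 1, by omega⟩
  have e : 2 ^ (G + 1) = 2 * 2 ^ G := by ring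
  by_cases hsl : 2 ^ (G + 1) ≤ 2 * s.val
  · have hlog : Nat.log 2 s.val = G :=
      (Nat.log_eq_iff (Or.inr ⟨by norm_num, hs⟩)).mpr ⟨by omega, hsH⟩
    rw [treeNext_eq_treeTerminal (by omega), hqT]
    simp only [q, hlog, Nat.add_sub_cancel, Nat.sub_self, pow_zero, Nat.div_one, mul_zero,
      add_zero, Fin.ext_iff]
    congr 1
    exact propext (by omega)
  · have hn : 2 * s.val + a.val < 2 ^ (G + 1) := by omega
    have hv := treeNext_val hs hn
    have hlogn : Nat.log 2 (2 * s.val + a.val) = Nat.log 2 s.val + 1 := by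
      rw [Nat.log_of_one_lt_of_le (by norm_num) (by omega)]
      congr 2
      omega
    have hlt : Nat.log 2 s.val < G := Nat.log_lt_of_lt_pow hs (by omega)
    obtain ⟨j, hj⟩ : ∃ j, G = Nat.log 2 s.val + 1 + j := ⟨G - (Nat.log 2 s.val + 1), by omega⟩
    have hj1 : G + 1 - 1 - Nat.log 2 s.val = j + 1 := by omega
    have hj2 : G + 1 - 1 - (Nat.log 2 s.val + 1) = j := by omega
    rw [if_neg (by rw [Fin.ext_iff]; omega), zero_add, iSup_fin_two]
    simp only [q, hv, hlogn, hj1, hj2, Fin.val_zero, Fin.val_one, add_zero]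
    have hdiv : m / 2 ^ (j + 1) = m / 2 ^ j / 2 := by rw [pow_succ, Nat.div_div_eq_div_mul]
    rw [hdiv]
    have hg : 0 < γ ^ j := by positivity
    -- The parity tells which action at the child continues the path; at most one of the two values
    -- in the maximum is nonzero.
    rcases Nat.even_or_odd' (m / 2 ^ j) with ⟨c, hc | hc⟩ <;> rw [hc]
    · rw [show 2 * c / 2 = c by omega]
      by_cases hcs : 2 * s.val + a.val = c
      · rw [if_pos (by omega), if_neg (by omega), if_pos ⟨hs, hcs⟩, max_eq_left hg.le, pow_succ']
      · rw [if_neg (by omega), if_neg (by omega), if_neg (by omega), max_self, mul_zero]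
    · rw [show (2 * c + 1) / 2 = c by omega]
      by_cases hcs : 2 * s.val + a.val = c
      · rw [if_neg (by omega), if_pos (by omega), if_pos ⟨hs, hcs⟩, max_eq_right hg.le, pow_succ']
      · rw [if_neg (by omega), if_neg (by omega), if_neg (by omega), max_self, mul_zero]

end TreeMDP

/-! ### Least squares and the level-wise features. -/

/-- The normal equations of a weighted least-squares projection. -/
theorem FiniteMDP.IsProjection.normal_eq {S A : Type} [Fintype S] [Fintype A] {d : ℕ}
    {Φ : Matrix (S × A) (Fin d) ℝ} {μ Y : S × A → ℝ} {w : Fin d → ℝ}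
    (h : IsProjection Φ μ Y w) (v : Fin d → ℝ) :
    ∑ x, μ x * ((linearQ Φ w x - Y x) * linearQ Φ v x) = 0 := by
  set a := ∑ x, μ x * ((linearQ Φ w x - Y x) * linearQ Φ v x) with ha
  set b := ∑ x, μ x * linearQ Φ v x ^ 2 with hb
  have key : ∀ t : ℝ, 0 ≤ b * (t * t) + 2 * a * t + 0 := by
    intro t
    have h1 := h (w + t • v)
    have h2 : sqLoss μ (linearQ Φ (w + t • v)) Y =
        sqLoss μ (linearQ Φ w) Y + (b * (t * t) + 2 * a * t) := by
      simp only [sqLoss, ha, hb, Finset.mul_sum, Finset.sum_mul, ← Finset.sum_add_distrib]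
      refine Finset.sum_congr rfl fun x _ => ?_
      have : linearQ Φ (w + t • v) x = linearQ Φ w x + t * linearQ Φ v x := by
        simp [linearQ, Matrix.mulVec_add, Matrix.mulVec_smul]
      rw [this]
      ring
    linarith
  -- A nonnegative quadratic with zero constant term has no linear term.
  have := discrim_le_zero key
  rw [discrim] at this
  nlinarith [sq_nonneg a]

/-- Features whose blocks of columns belong to the levels of the tree: the pair `(s, a)` has
the vector `ψ (2 * s + a)` in the block of the level of `s`. -/
noncomputable def treeFeatures (H D : ℕ) (ψ : ℕ → Fin (2 ^ D) → ℝ) :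
    Matrix (TreeState H × Fin 2) (Fin (H * 2 ^ D)) ℝ := fun x j =>
  if x.1.val ≠ 0 ∧ (finProdFinEquiv.symm j).1.val = Nat.log 2 x.1.val then
    ψ (2 * x.1.val + x.2.val) (finProdFinEquiv.symm j).2
  else 0

section Features

variable {H D : ℕ} {ψ : ℕ → Fin (2 ^ D) → ℝ}

theorem log_treeState_lt {s : TreeState H} (hs : s.val ≠ 0) : Nat.log 2 s.val < H :=
  Nat.log_lt_of_lt_pow hs s.isLt

theorem treeFeatures_terminal {s : TreeState H} (hs : s.val = 0) (a : Fin 2)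
    (j : Fin (H * 2 ^ D)) : treeFeatures H D ψ (s, a) j = 0 :=
  if_neg fun h => h.1 hs

theorem sum_treeFeatures_mul {s : TreeState H} (hs : s.val ≠ 0) (a : Fin 2)
    (f : Fin (H * 2 ^ D) → ℝ) :
    ∑ j, treeFeatures H D ψ (s, a) j * f j =
      ∑ i, ψ (2 * s.val + a.val) i * f (finProdFinEquiv (⟨_, log_treeState_lt hs⟩, i)) := by
  rw [← finProdFinEquiv.sum_comp, Fintype.sum_prod_type,
    Finset.sum_eq_single (⟨_, log_treeState_lt hs⟩ : Fin H)]
  · simp [treeFeatures, hs]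
  · intro h _ hne
    refine Finset.sum_eq_zero fun i _ => ?_
    have : h.val ≠ Nat.log 2 s.val := fun hc => hne (Fin.ext hc)
    simp [treeFeatures, this]
  · simp

theorem linearQ_treeFeatures_terminal {s : TreeState H} (hs : s.val = 0) (a : Fin 2)
    (w : Fin (H * 2 ^ D) → ℝ) : linearQ (treeFeatures H D ψ) w (s, a) = 0 := by
  change ∑ j, treeFeatures H D ψ (s, a) j * w j = 0
  exact Finset.sum_eq_zero fun j _ => by rw [treeFeatures_terminal hs, zero_mul]

theorem linearQ_treeFeatures {s : TreeState H} (hs : s.val ≠ 0) (a : Fin 2)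
    (w : Fin (H * 2 ^ D) → ℝ) :
    linearQ (treeFeatures H D ψ) w (s, a) =
      ∑ i, ψ (2 * s.val + a.val) i * w (finProdFinEquiv (⟨_, log_treeState_lt hs⟩, i)) :=
  sum_treeFeatures_mul hs a w

theorem pair_lt (s : TreeState H) (a : Fin 2) : 2 * s.val + a.val < 2 ^ (H + 1) := by
  have := s.isLt
  have := a.isLt
  have e : 2 ^ (H + 1) = 2 * 2 ^ H := by ring
  omega

theorem isEpsRankFeatures_treeFeatures {ε : ℝ} (hε : 0 ≤ ε)
    (hψ : IsBlockFrame ε (2 ^ (H + 1)) D ψ) : IsEpsRankFeatures ε (treeFeatures H D ψ) := by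
  refine ⟨fun a j => treeFeatures_terminal rfl a j, ?_⟩
  rintro ⟨s, a⟩ ⟨s', a'⟩ hs hs'
  simp only [ne_eq, eq_treeTerminal_iff] at hs hs'
  rw [Matrix.sub_apply, Matrix.mul_apply]
  simp only [Matrix.transpose_apply]
  rw [sum_treeFeatures_mul hs]
  by_cases hlog : Nat.log 2 s.val = Nat.log 2 s'.val
  · have h1 : ∀ i, treeFeatures H D ψ (s', a')
        (finProdFinEquiv (⟨_, log_treeState_lt hs⟩, i)) = ψ (2 * s'.val + a'.val) i := by
      intro i
      simp [treeFeatures, hs', hlog]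
    simp only [h1]
    by_cases heq : (s, a) = (s', a')
    · rw [heq, Matrix.one_apply_eq]
      obtain ⟨rfl, rfl⟩ := Prod.mk.inj heq
      rw [hψ.unit, sub_self, abs_zero]
      exact hε
    · rw [Matrix.one_apply_ne heq, zero_sub, abs_neg]
      refine hψ.almost_orthogonal _ (pair_lt s a) _ (pair_lt s' a') fun h => heq ?_
      have := a.isLt
      have := a'.isLt
      rw [Prod.mk.injEq, Fin.ext_iff, Fin.ext_iff]
      omega
  · have hne : (s, a) ≠ (s', a') := fun h => hlog (by rw [(Prod.mk.inj h).1])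
    rw [Matrix.one_apply_ne hne, Finset.sum_eq_zero, sub_zero, abs_zero]
    · exact hε
    · intro i _
      simp [treeFeatures, hlog]

/-- `Q*` has one nonzero pair on each level. Using that pair's scaled feature vector as the block of
weights leaves, at any other pair, a single inner product as error, so errors do not accumulate. -/
theorem exists_linearQ_near_Qstar {ε γ : ℝ} (hε : 0 ≤ ε) (hψ : IsBlockFrame ε (2 ^ (H + 1)) D ψ)
    (hγ0 : 0 < γ) (hγ1 : γ < 1) (sStar : TreeState H) (aStar : Fin 2)
    (hleaf : IsTreeLeaf sStar) :
    ∃ w, ‖(treeMDP H γ hγ0 hγ1 sStar aStar).Qstar -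
      linearQ (treeFeatures H D ψ) w‖ ≤ ε := by
  let node : ℕ → ℕ := fun l => (2 * sStar.val + aStar.val) / 2 ^ (H - 1 - l)
  refine ⟨fun j => γ ^ (H - 1 - (finProdFinEquiv.symm j).1.val) *
    ψ (node (finProdFinEquiv.symm j).1.val) (finProdFinEquiv.symm j).2,
    (pi_norm_le_iff_of_nonneg hε).mpr ?_⟩
  rintro ⟨s, a⟩
  rw [Pi.sub_apply, Qstar_treeMDP hγ0 hγ1 sStar aStar hleaf, Real.norm_eq_abs]
  by_cases hs : s.val = 0
  · rw [linearQ_treeFeatures_terminal hs, if_neg fun h => h.1 hs]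
    simpa using hε
  rw [linearQ_treeFeatures hs]
  simp only [Equiv.symm_apply_apply]
  set g := γ ^ (H - 1 - Nat.log 2 s.val)
  have hg0 : 0 ≤ g := by positivity
  have hg1 : g ≤ 1 := pow_le_one₀ hγ0.le hγ1.le
  have hsum : ∑ i, ψ (2 * s.val + a.val) i * (g * ψ (node (Nat.log 2 s.val)) i) =
      g * ∑ i, ψ (2 * s.val + a.val) i * ψ (node (Nat.log 2 s.val)) i := by
    rw [Finset.mul_sum]
    exact Finset.sum_congr rfl fun i _ => by ring
  rw [hsum]
  by_cases h : 2 * s.val + a.val = node (Nat.log 2 s.val)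
  · rw [if_pos ⟨hs, h⟩, ← h, hψ.unit]
    simpa using hε
  · rw [if_neg fun hc => h hc.2, zero_sub, abs_neg, abs_mul, abs_of_nonneg hg0]
    have h1 := hψ.almost_orthogonal _ (pair_lt s a) (node (Nat.log 2 s.val))
      (lt_of_le_of_lt (Nat.div_le_self _ _) (pair_lt sStar aStar)) h
    calc g * _ ≤ 1 * ε := mul_le_mul hg1 h1 (abs_nonneg _) zero_le_one
      _ = ε := one_mul ε

/-- After any projection step the value of the rewarded pair is exponentially small. -/
theorem linearQ_rewarded_le {ε γ p : ℝ} (hψ : IsBlockFrame ε (2 ^ (H + 1)) D ψ)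
    (hD : D ≤ H) (hH : 1 ≤ H) (hγ0 : 0 < γ) (hγ1 : γ < 1) (sStar : TreeState H) (aStar : Fin 2)
    (hleaf : IsTreeLeaf sStar) (hp : 0 < p) (hp1 : p ≤ 1) {μ : TreeState H × Fin 2 → ℝ}
    {P : ℕ → ℝ} (hP : IsTreeSplitting p H P)
    (hμ : ∀ (s : TreeState H) (a : Fin 2), s.val ≠ 0 →
      μ (s, a) = (1 - γ) * γ ^ Nat.log 2 s.val * P (2 * s.val + a.val))
    {w w' : Fin (H * 2 ^ D) → ℝ}
    (hw : IsProjection (treeFeatures H D ψ) μ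
      ((treeMDP H γ hγ0 hγ1 sStar aStar).bellman (linearQ (treeFeatures H D ψ) w')) w) :
    p ^ D * linearQ (treeFeatures H D ψ) w (sStar, aStar) ≤ (1 - p) ^ H := by
  set Y := (treeMDP H γ hγ0 hγ1 sStar aStar).bellman (linearQ (treeFeatures H D ψ) w') with hY
  have hl : 2 ^ H ≤ 2 * sStar.val := hleaf
  have hHpos := Nat.two_pow_pos H
  obtain ⟨G, rfl⟩ : ∃ G, H = G + 1 := ⟨H - 1, by omega⟩
  have e : 2 ^ (G + 1) = 2 * 2 ^ G := by ring
  have e2 : 2 ^ (G + 1 + 1) = 2 * 2 ^ (G + 1) := by ring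
  have hlog : ∀ s : TreeState (G + 1), 2 ^ (G + 1) ≤ 2 * s.val → Nat.log 2 s.val = G :=
    fun s hs => (Nat.log_eq_iff (Or.inr ⟨by norm_num, by omega⟩)).mpr ⟨by omega, s.isLt⟩
  -- the leaf block of `w`, and its Q-function
  let u : Fin (2 ^ D) → ℝ := fun i => w (finProdFinEquiv (⟨G, Nat.lt_succ_self G⟩, i))
  let v : Fin ((G + 1) * 2 ^ D) → ℝ := fun j =>
    if (finProdFinEquiv.symm j).1.val = G then w j else 0
  let f : ℕ → ℝ := fun n => ∑ i, ψ n i * u i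
  have hwf : ∀ (s : TreeState (G + 1)) (a : Fin 2), 2 ^ (G + 1) ≤ 2 * s.val →
      linearQ (treeFeatures (G + 1) D ψ) w (s, a) = f (2 * s.val + a.val) := by
    intro s a hs
    rw [linearQ_treeFeatures (by omega)]
    simp only [hlog s hs, f, u]
  have hvf : ∀ (s : TreeState (G + 1)) (a : Fin 2), 2 ^ (G + 1) ≤ 2 * s.val →
      linearQ (treeFeatures (G + 1) D ψ) v (s, a) = f (2 * s.val + a.val) := by
    intro s a hs
    rw [linearQ_treeFeatures (by omega)]
    simp only [hlog s hs, f, u, v, Equiv.symm_apply_apply, if_true]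
  have hv0 : ∀ (s : TreeState (G + 1)) (a : Fin 2), ¬ 2 ^ (G + 1) ≤ 2 * s.val →
      linearQ (treeFeatures (G + 1) D ψ) v (s, a) = 0 := by
    intro s a hs
    by_cases hs0 : s.val = 0
    · exact linearQ_treeFeatures_terminal hs0 a v
    · rw [linearQ_treeFeatures hs0]
      have : Nat.log 2 s.val ≠ G := (Nat.log_lt_of_lt_pow hs0 (by omega)).ne
      simp only [v, Equiv.symm_apply_apply, if_neg this, mul_zero, Finset.sum_const_zero]
  -- The successor of a leaf is terminal, where the features vanish, so `w'` drops out.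
  have hYleaf : ∀ (s : TreeState (G + 1)) (a : Fin 2), 2 ^ (G + 1) ≤ 2 * s.val →
      Y (s, a) = if 2 * s.val + a.val = 2 * sStar.val + aStar.val then 1 else 0 := by
    intro s a hs
    have ha := a.isLt
    have haS := aStar.isLt
    rw [hY, bellman_treeMDP, treeNext_eq_treeTerminal (by omega)]
    simp only [linearQ_treeFeatures_terminal (s := treeTerminal (G + 1)) rfl, ciSup_const,
      mul_zero, add_zero, Fin.ext_iff]
    congr 1
    exact propext (by omega)
  set m := 2 * sStar.val + aStar.val with hm
  have hmlt : m < 2 ^ (G + 1 + 1) := pair_lt sStar aStar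
  have hγG : 0 < (1 - γ) * γ ^ G := mul_pos (by linarith) (by positivity)
  -- the normal equation on the leaf level
  have hnormal : ∑ n ∈ Finset.Ico (2 ^ (G + 1)) (2 ^ (G + 1 + 1)), P n * f n ^ 2 =
      P m * f m := by
    have h0 := hw.normal_eq v
    -- The discount factor is constant on the leaf level and cancels from the equation.
    let F : ℕ → ℝ := fun n => if 2 ^ (G + 1) ≤ n then ((1 - γ) * γ ^ G) *
      (P n * f n ^ 2 - if n = m then P m * f m else 0) else 0
    have h1 : ∀ x : TreeState (G + 1) × Fin 2,
        μ x * ((linearQ (treeFeatures (G + 1) D ψ) w x - Y x) *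
          linearQ (treeFeatures (G + 1) D ψ) v x) =
        F (2 * x.1.val + x.2.val) := by
      rintro ⟨s, a⟩
      have ha := a.isLt
      by_cases hs : 2 ^ (G + 1) ≤ 2 * s.val
      · simp only [F]
        rw [if_pos (by omega), hwf s a hs, hvf s a hs, hYleaf s a hs, hμ s a (by omega),
          hlog s hs]
        split_ifs with h
        · rw [h]; ring
        · ring
      · simp only [F]
        rw [hv0 s a hs, if_neg (by omega), mul_zero, mul_zero]
    rw [Finset.sum_congr rfl fun x _ => h1 x, sum_treeState_prod F, ← Finset.sum_filter] at h0
    have h2 : (Finset.range (2 ^ (G + 1 + 1))).filter (2 ^ (G + 1) ≤ ·) =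
        Finset.Ico (2 ^ (G + 1)) (2 ^ (G + 1 + 1)) := by
      ext n
      simp [and_comm]
    rw [h2, ← Finset.mul_sum, Finset.sum_sub_distrib, Finset.sum_ite_eq',
      if_pos (Finset.mem_Ico.mpr ⟨by omega, hmlt⟩)] at h0
    have := (mul_eq_zero.mp h0).resolve_left hγG.ne'
    linarith
  -- every bottom subtree carries an orthonormal basis
  have hparseval : p ^ D * ∑ i, u i ^ 2 ≤
      ∑ n ∈ Finset.Ico (2 ^ (G + 1)) (2 ^ (G + 1 + 1)), P n * f n ^ 2 := by
    -- Pairs of the leaf level sit at depth `H = J + D` in the numbering `2 * s + a`, so each node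
    -- at depth `J` has exactly one basis block below it.
    obtain ⟨J, hJ⟩ : ∃ J, G + 1 = J + D := ⟨G + 1 - D, by omega⟩
    have e3 : 2 ^ (G + 1) = 2 ^ J * 2 ^ D := by rw [hJ, pow_add]
    have e4 : 2 ^ (G + 1 + 1) = 2 ^ (J + 1) * 2 ^ D := by rw [e2, e3]; ring
    rw [e3, e4, sum_Ico_mul _ _ (Nat.pow_le_pow_right (by norm_num) (Nat.le_succ J))]
    calc p ^ D * ∑ i, u i ^ 2
        = ∑ t ∈ Finset.Ico (2 ^ J) (2 ^ (J + 1)), p ^ D * P t * ∑ i, u i ^ 2 := by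
          rw [← Finset.sum_mul, ← Finset.mul_sum, hP.sum_level (by omega), mul_one]
      _ ≤ _ := by
          refine Finset.sum_le_sum fun t ht => ?_
          rw [Finset.mem_Ico] at ht
          have := Nat.two_pow_pos J
          rw [← hψ.parseval t u, Finset.mul_sum]
          refine Finset.sum_le_sum fun b hb => ?_
          rw [Finset.mem_range] at hb
          refine mul_le_mul_of_nonneg_right
            (hP.le_descendant hp.le (by omega) hb ?_) (sq_nonneg _)
          rw [e4]
          calc t * 2 ^ D + b < (t + 1) * 2 ^ D := by rw [Nat.succ_mul]; omega
            _ ≤ 2 ^ (J + 1) * 2 ^ D := Nat.mul_le_mul_right _ (by omega)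
  have hcs : f m ^ 2 ≤ ∑ i, u i ^ 2 := by
    have h1 := Finset.sum_mul_sq_le_sq_mul_sq Finset.univ (ψ m) u
    have h2 : ∑ i, ψ m i ^ 2 = 1 := by simpa only [sq] using hψ.unit m
    rwa [h2, one_mul] at h1
  have hPm : P m ≤ (1 - p) ^ (G + 1) := hP.le_pow hp1 le_rfl (by omega) hmlt
  have hpD : 0 < p ^ D := by positivity
  rw [hwf sStar aStar hl, ← hm]
  rcases le_or_gt (f m) 0 with hf | hf
  · exact le_trans (mul_nonpos_of_nonneg_of_nonpos hpD.le hf) (pow_nonneg (by linarith) _)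
  · have h1 : p ^ D * f m * f m ≤ P m * f m := by
      calc p ^ D * f m * f m = p ^ D * f m ^ 2 := by ring
        _ ≤ p ^ D * ∑ i, u i ^ 2 := mul_le_mul_of_nonneg_left hcs hpD.le
        _ ≤ P m * f m := hparseval.trans hnormal.le
    exact (le_of_mul_le_mul_right h1 hf).trans hPm

end Features

/-! ### Asymptotics and conclusion. -/

open Filter Topology in
/-- The exponential decay beats the polynomial growth that comes from `D = O(log H)`. -/
theorem exists_forall_pow_lt {B p δ : ℝ} (hp : 0 < p) (hp1 : p < 1) (hδ : 0 < δ) :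
    ∃ H₀ : ℕ, ∀ H ≥ H₀, ∀ D : ℕ, (2 ^ D : ℝ) ≤ B * H →
      D ≤ H ∧ (1 - p) ^ H < p ^ D * δ := by
  -- `p ^ m < 1 / 2` converts `p ^ D` into a power of the dimension: `p ^ D ≥ (2 ^ D) ^ (-m) ≥ (B *
  -- H) ^ (-m)`.
  obtain ⟨m, hm⟩ := exists_pow_lt_of_lt_one hp (by norm_num : (1 / 2 : ℝ) < 1)
  have ht1 : Tendsto (fun H : ℕ => B ^ m * ((H : ℝ) ^ m * (1 - p) ^ H)) atTop (𝓝 0) := by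
    have := (tendsto_pow_const_mul_const_pow_of_abs_lt_one m
      (r := 1 - p) (by rw [abs_lt]; constructor <;> linarith)).const_mul (B ^ m)
    rwa [mul_zero] at this
  have ht2 : Tendsto (fun H : ℕ => B * ((H : ℝ) ^ 1 * (1 / 2 : ℝ) ^ H)) atTop (𝓝 0) := by
    have := (tendsto_pow_const_mul_const_pow_of_abs_lt_one 1
      (r := (1 / 2 : ℝ)) (by rw [abs_lt]; constructor <;> norm_num)).const_mul B
    rwa [mul_zero] at this
  obtain ⟨H₀, hH₀⟩ := eventually_atTop.mp
    ((ht1.eventually_lt_const hδ).and (ht2.eventually_lt_const one_pos))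
  refine ⟨H₀, fun H hH D hD => ?_⟩
  obtain ⟨h1, h2⟩ := hH₀ H hH
  constructor
  · have h3 : (2 : ℝ) ^ D < 2 ^ H := by
      refine lt_of_le_of_lt hD ?_
      have h4 : (0 : ℝ) < 2 ^ H := by positivity
      calc B * H = B * ((H : ℝ) ^ 1 * (1 / 2 : ℝ) ^ H) * 2 ^ H := by
            rw [one_div, inv_pow]; field_simp
        _ < 1 * 2 ^ H := mul_lt_mul_of_pos_right h2 h4
        _ = 2 ^ H := one_mul _
    exact ((pow_lt_pow_iff_right₀ one_lt_two).mp h3).le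
  · have h3 : (2 ^ D : ℝ) ^ m ≤ (B * H) ^ m := pow_le_pow_left₀ (by positivity) hD m
    have h4 : (1 : ℝ) ≤ (2 ^ D) ^ m * p ^ D := by
      have : (1 : ℝ) = (2 ^ D) ^ m * ((1 / 2) ^ m) ^ D := by
        rw [← pow_mul, ← pow_mul, mul_comm m D, ← mul_pow]; norm_num
      rw [this]
      exact mul_le_mul_of_nonneg_left (pow_le_pow_left₀ (by positivity) hm.le D) (by positivity)
    have hq : 0 < (1 - p) ^ H := pow_pos (by linarith) _
    have hpD : 0 < p ^ D := by positivity
    calc (1 - p) ^ H ≤ ((2 ^ D) ^ m * p ^ D) * (1 - p) ^ H := le_mul_of_one_le_left hq.le h4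
      _ ≤ ((B * H) ^ m * p ^ D) * (1 - p) ^ H := by gcongr
      _ = p ^ D * (B ^ m * ((H : ℝ) ^ m * (1 - p) ^ H)) := by rw [mul_pow]; ring
      _ < p ^ D * δ := mul_lt_mul_of_pos_left h1 hpD

theorem theorem1 :
    ∃ C : ℝ, 0 < C ∧
    ∀ (ε : ℝ), 0 < ε → ε < 1 → ∀ (γ : ℝ) (hγ0 : 0 < γ) (hγ1 : γ < 1),
    ∃ (d : ℕ → ℕ) (Φ : (H : ℕ) → Matrix (TreeState H × Fin 2) (Fin (d H)) ℝ),
      -- the features: low-dimensional, nearly orthonormal, and nearly representing `Q*`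
      (∀ H : ℕ, 1 ≤ H →
        (d H : ℝ) ≤ C * (H : ℝ) ^ 2 / ε ^ 2 ∧
        IsEpsRankFeatures ε (Φ H) ∧
        ∀ (sStar : TreeState H) (aStar : Fin 2), IsTreeLeaf sStar →
          ∃ w : Fin (d H) → ℝ,
            ‖(treeMDP H γ hγ0 hγ1 sStar aStar).Qstar - FiniteMDP.linearQ (Φ H) w‖ ≤ ε) ∧
      -- the lower bound, for exploring policies and every target accuracy `η < 1`
      ∀ (p : ℝ), 0 < p → p < 1 / 2 → ∀ (η : ℝ), 0 < η → η < 1 →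
      ∃ c : ℝ, 0 < c ∧
      ∀ (H : ℕ), 1 ≤ H → ∀ (sStar : TreeState H) (aStar : Fin 2), IsTreeLeaf sStar →
      ∀ (π : ℕ → Policy (TreeState H) (Fin 2)), (∀ k s a, p ≤ (π k).prob s a) →
      ∀ (μ : ℕ → TreeState H × Fin 2 → ℝ),
        (μ = (treeMDP H γ hγ0 hγ1 sStar aStar).onPolicyData π ∨
          μ = (treeMDP H γ hγ0 hγ1 sStar aStar).replayData π) →
      ∀ (w : ℕ → Fin (d H) → ℝ),
        (treeMDP H γ hγ0 hγ1 sStar aStar).IsFittedQRun (Φ H) μ w →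
        η < ‖FiniteMDP.linearQ (Φ H) (w 0) - (treeMDP H γ hγ0 hγ1 sStar aStar).Qstar‖ →
        ∀ K : ℕ,
          ‖FiniteMDP.linearQ (Φ H) (w K) - (treeMDP H γ hγ0 hγ1 sStar aStar).Qstar‖ ≤ η →
          c * (γ ^ H)⁻¹ ≤ (K : ℝ) := by
  refine ⟨16, by norm_num, fun ε hε hε1 γ hγ0 hγ1 => ?_⟩
  have hframe : ∀ H : ℕ, ∃ (D : ℕ) (ψ : ℕ → Fin (2 ^ D) → ℝ), 1 ≤ H →
      (2 ^ D : ℝ) ≤ 16 * H / ε ^ 2 ∧ IsBlockFrame ε (2 ^ (H + 1)) D ψ := by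
    intro H
    by_cases hH : 1 ≤ H
    · obtain ⟨D, ψ, h⟩ := exists_nearly_minimal_isBlockFrame hH hε hε1
      exact ⟨D, ψ, fun _ => h⟩
    · exact ⟨0, fun _ _ => 0, fun h => absurd h hH⟩
  choose D ψ hψ using hframe
  refine ⟨fun H => H * 2 ^ D H, fun H => treeFeatures H (D H) (ψ H), fun H hH => ?_, ?_⟩
  · obtain ⟨hD, hF⟩ := hψ H hH
    refine ⟨?_, isEpsRankFeatures_treeFeatures hε.le hF, fun sStar aStar hleaf =>
      exists_linearQ_near_Qstar hε.le hF hγ0 hγ1 sStar aStar hleaf⟩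
    push_cast
    calc (H : ℝ) * 2 ^ D H ≤ H * (16 * H / ε ^ 2) := by gcongr
      _ = 16 * (H : ℝ) ^ 2 / ε ^ 2 := by ring
  · intro p hp hp2 η hη hη1
    -- The margin is `1 - η` because `Q*` is `1` at the rewarded pair.
    obtain ⟨H₀, hH₀⟩ := exists_forall_pow_lt (B := 16 / ε ^ 2) hp (by linarith)
      (sub_pos.mpr hη1)
    -- For `H < H₀` this makes the claimed bound at most `1`, and `K ≥ 1` because the initialization
    -- is not accurate.
    refine ⟨γ ^ H₀, by positivity, ?_⟩
    intro H hH sStar aStar hleaf π hπ μ hμ w hrun hinit K hK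
    obtain ⟨k, rfl⟩ : ∃ k, K = k + 1 := by
      refine Nat.exists_eq_succ_of_ne_zero ?_
      rintro rfl
      exact absurd hK (not_le.mpr hinit)
    rcases lt_or_ge H H₀ with hlt | hge
    · have h1 : γ ^ H₀ * (γ ^ H)⁻¹ ≤ 1 := by
        rw [← div_eq_mul_inv, div_le_one (by positivity)]
        exact pow_le_pow_of_le_one hγ0.le hγ1.le hlt.le
      refine h1.trans ?_
      push_cast
      linarith [Nat.cast_nonneg (α := ℝ) k]
    -- From `H₀` on, the last projection alone already rules out accuracy, whatever the earlier
    -- iterates were.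
    · exfalso
      obtain ⟨hD, hF⟩ := hψ H hH
      obtain ⟨hDH, hsmall⟩ := hH₀ H hge (D H) (by rw [div_mul_eq_mul_div]; exact hD)
      obtain ⟨P, hP, hμP⟩ := exists_isTreeSplitting_data hγ0 hγ1 sStar aStar hπ hμ k
      have hle := linearQ_rewarded_le hF hDH hH hγ0 hγ1 sStar aStar hleaf hp (by linarith)
        hP hμP (hrun k)
      have hlt := lt_of_mul_lt_mul_left (hle.trans_lt hsmall) (by positivity)
      have hpt := (norm_le_pi_norm _ (sStar, aStar)).trans hK
      have hl : 2 ^ H ≤ 2 * sStar.val := hleaf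
      have hs0 : sStar.val ≠ 0 := by
        have := Nat.two_pow_pos H
        omega
      have hlog : Nat.log 2 sStar.val = H - 1 := by
        obtain ⟨G, rfl⟩ : ∃ G, H = G + 1 := ⟨H - 1, by omega⟩
        have e : 2 ^ (G + 1) = 2 * 2 ^ G := by ring
        exact (Nat.log_eq_iff (Or.inr ⟨by norm_num, hs0⟩)).mpr ⟨by simp; omega, sStar.isLt⟩
      rw [Pi.sub_apply, Qstar_treeMDP hγ0 hγ1 sStar aStar hleaf, hlog, Nat.sub_self, pow_zero,
        Nat.div_one, if_pos ⟨hs0, rfl⟩, Real.norm_eq_abs] at hpt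
      linarith [(abs_le.mp hpt).1]
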